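/- Let $A_0,A_1$ be real symmetric $N\times N$ matrices with $A_1$ positive semidefinite, and put $A(t)=A_0+tA_1$. Let $\lambda(t)\in\mathbb{R}$ and $v(t)\in\mathbb{R}^N\setminus\{0\}$ be real-analytic near every point of $[0,1]$ with $A(t)v(t)=\lambda(t)v(t)$ for all $t\in[0,1]$, and write $\lambda_0=\lambda(0)$, $v_0=v(0)$. Let $\|\cdot\|_F$ denote the Frobenius norm. Call $v$ \emph{aligned} if for every $t\in[0,1]$ the orthogonal projection of $v(t)$ to $\ker(A_0-\lambda_0 I)$ is a multiple of $v_0$ (no condition when $\lambda_0$ is a simple eigenvalue of $A_0$). Call $v$ \emph{unit-normalized} if $\|v(t)\|_2=1$ for all $t\in[0,1]$, and \emph{intermediately normalized} if $\|v_0\|_2=1$ and $v_0^\top v(t)=1$ for all $t\in[0,1]$. There are absolute constants $C_\lambda,K>0$ such that the following holds for all such data. (i) Let $d_{\min}$ be the smallest positive distance between two eigenvalues of $A_0$ (assumed to exist). If $\|A_1\|_F<d_{\min}/6$, then $$|\lambda(1)-\lambda_0|\le C_\lambda\,\|A_1\|_F\left(1+\frac{\|A_1\|_F}{d_{\min}/6}\right)^{-1},$$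 and, if $v$ is aligned and either unit-normalized or intermediately normalized, $$\|v(1)-v_0\|_2\le C_v\,\|A_1\|_F\left(1+\frac{\|A_1\|_F}{d_{\min}/6}\right)^{-1}\qquad\text{with } C_v=K/d_{\min}.$$ (ii) Let instead $d_{\min}$ be the smallest positive entry of $A_0$ (assumed to exist). If $\|A_1\|_F<d_{\min}/6$, then the same bound holds for $|\lambda(1)-\lambda_0|$ with the same $C_\lambda$, and, if $v$ is aligned and unit-normalized, the same bound holds for $\|v(1)-v_0\|_2$ with some constant $C_v>0$ that depends only on $A_0$. -/

import Mathlib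

open Set
open scoped Matrix.Norms.Frobenius RealInnerProductSpace

/-- The positive distances between two eigenvalues of the matrix `A`. -/
def positiveSpectralDistances {N : ℕ} (A : Matrix (Fin N) (Fin N) ℝ) : Set ℝ :=
  {x | 0 < x ∧ ∃ μ ∈ spectrum ℝ A, ∃ ν ∈ spectrum ℝ A, x = μ - ν}

/-- The positive entries of the matrix `A`. -/
def positiveEntries {N : ℕ} (A : Matrix (Fin N) (Fin N) ℝ) : Set ℝ :=
  {x | 0 < x ∧ ∃ i j, x = A i j}

/-- `(lam t, v t)` is an eigenpair of `A₀ + t A₁` for all `t ∈ [0, 1]`,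
real-analytic in `t` near every point of `[0, 1]`. -/
structure IsAnalyticEigenpair {N : ℕ} (A₀ A₁ : Matrix (Fin N) (Fin N) ℝ)
    (lam : ℝ → ℝ) (v : ℝ → EuclideanSpace ℝ (Fin N)) : Prop where
  analytic_value : AnalyticOnNhd ℝ lam (Icc 0 1)
  analytic_vector : AnalyticOnNhd ℝ v (Icc 0 1)
  vector_ne_zero : ∀ t ∈ Icc (0 : ℝ) 1, v t ≠ 0
  eigen : ∀ t ∈ Icc (0 : ℝ) 1, Matrix.toEuclideanLin (A₀ + t • A₁) (v t) = lam t • v t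

/-- The projection of `v t` to the eigenspace of `A₀` that contains `v 0` is a multiple of `v 0`:
every eigenvector of `A₀` with eigenvalue `lam0` that is orthogonal to `v 0` is orthogonal to
`v t`. No condition if the eigenvalue `lam0` of `A₀` is simple. -/
def IsAligned {N : ℕ} (A₀ : Matrix (Fin N) (Fin N) ℝ) (lam0 : ℝ)
    (v : ℝ → EuclideanSpace ℝ (Fin N)) : Prop :=
  ∀ u : EuclideanSpace ℝ (Fin N), Matrix.toEuclideanLin A₀ u = lam0 • u → ⟪u, v 0⟫ = 0 →
    ∀ t ∈ Icc (0 : ℝ) 1, ⟪u, v t⟫ = 0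

/-- Unit normalization of an eigenvector curve. -/
def IsUnitNormalized {N : ℕ} (v : ℝ → EuclideanSpace ℝ (Fin N)) : Prop :=
  ∀ t ∈ Icc (0 : ℝ) 1, ‖v t‖ = 1

/-- Intermediate normalization of an eigenvector curve: `v 0` is a unit vector and all the
corrections `v t - v 0` are orthogonal to it. -/
def IsIntermediateNormalized {N : ℕ} (v : ℝ → EuclideanSpace ℝ (Fin N)) : Prop :=
  ‖v 0‖ = 1 ∧ ∀ t ∈ Icc (0 : ℝ) 1, ⟪v 0, v t⟫ = 1

/-! Since `‖A₁‖ < d / 6`, the factor `(1 + ‖A₁‖ / (d / 6))⁻¹` is at least `1 / 2`, so bounds linear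
in `‖A₁‖` suffice. For the eigenvalue, Hellmann–Feynman gives `|λ'| ≤ ‖A₁‖`, and the mean value
theorem finishes. For the vector, let `w` be the component of `v t` orthogonal to `v 0`. Alignment
makes `w` orthogonal to the whole eigenspace of `λ₀`, where `A₀ - λ₀` is bounded below by the gap
(`gap_mul_norm_le`). But `(A₀ - λ₀) w = (λ t - λ₀) v t - t A₁ (v t)` has norm at most `2 ‖A₁‖ ‖v
t‖`. In (ii) the entry `d` says nothing about the spectrum, so `Cv` comes from a spectral gap `g` of
`A₀`. -/

open Module.End in
/-- A symmetric operator is bounded below by its spectral gap on the orthogonal complement of an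
eigenspace. -/
theorem LinearMap.IsSymmetric.gap_mul_norm_le {E : Type*} [NormedAddCommGroup E]
    [InnerProductSpace ℝ E] [FiniteDimensional ℝ E] {T : E →ₗ[ℝ] E} (hT : T.IsSymmetric)
    {μ g : ℝ} (hg : 0 ≤ g) (hgap : ∀ ν, HasEigenvalue T ν → ν ≠ μ → g ≤ |ν - μ|)
    {w : E} (hw : ∀ u, T u = μ • u → ⟪u, w⟫ = 0) :
    g * ‖w‖ ≤ ‖T w - μ • w‖ := by
  set b := hT.eigenvectorBasis rfl
  have hcoord : ∀ i, ⟪b i, T w - μ • w⟫ = (hT.eigenvalues rfl i - μ) * ⟪b i, w⟫ := by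
    intro i
    have hb : T (b i) = hT.eigenvalues rfl i • b i := hT.apply_eigenvectorBasis rfl i
    rw [inner_sub_right, ← hT, hb, inner_smul_left, inner_smul_right]
    simp only [conj_trivial]
    ring
  have hle : ∀ i, g ^ 2 * ‖⟪b i, w⟫‖ ^ 2 ≤ ‖⟪b i, T w - μ • w⟫‖ ^ 2 := by
    intro i
    rw [hcoord, norm_mul, mul_pow]
    by_cases h : hT.eigenvalues rfl i = μ
    · have hb : T (b i) = μ • b i := by rw [← h]; exact hT.apply_eigenvectorBasis rfl i
      simp [hw _ hb]
    · have hi : g ≤ |hT.eigenvalues rfl i - μ| := hgap _ (hT.hasEigenvalue_eigenvalues rfl i) h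
      rw [Real.norm_eq_abs (_ - _)]
      gcongr
  refine le_of_sq_le_sq ?_ (norm_nonneg _)
  rw [mul_pow, ← b.sum_sq_norm_inner_right w, ← b.sum_sq_norm_inner_right, Finset.mul_sum]
  exact Finset.sum_le_sum fun i _ => hle i

theorem Matrix.norm_toEuclideanLin_le_frobenius {m n : Type*} [Fintype m] [Fintype n]
    [DecidableEq n] (A : Matrix m n ℝ) (x : EuclideanSpace ℝ n) :
    ‖Matrix.toEuclideanLin A x‖ ≤ ‖A‖ * ‖x‖ := by
  have h := Matrix.frobenius_norm_mul A (Matrix.replicateCol Unit x.ofLp)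
  rw [← Matrix.replicateCol_mulVec, Matrix.frobenius_norm_replicateCol,
    Matrix.frobenius_norm_replicateCol] at h
  exact h

/-- The positive spectral distances of a matrix are bounded away from zero. -/
theorem exists_spectral_gap {N : ℕ} (A : Matrix (Fin N) (Fin N) ℝ) :
    ∃ g : ℝ, 0 < g ∧ ∀ x ∈ positiveSpectralDistances A, g ≤ x := by
  have hfin : (positiveSpectralDistances A).Finite := by
    refine ((A.finite_spectrum.prod A.finite_spectrum).image fun p => p.1 - p.2).subset ?_
    rintro x ⟨-, μ, hμ, ν, hν, rfl⟩
    exact ⟨(μ, ν), ⟨hμ, hν⟩, rfl⟩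
  rcases (positiveSpectralDistances A).eq_empty_or_nonempty with h | h
  · exact ⟨1, one_pos, by simp [h]⟩
  · obtain ⟨g, hg, hmin⟩ := hfin.exists_minimal h
    refine ⟨g, hg.1, fun x hx => ?_⟩
    rcases le_total g x with h' | h'
    · exact h'
    · exact hmin hx h'

section Eigenpair

variable {N : ℕ} {A₀ A₁ : Matrix (Fin N) (Fin N) ℝ} {lam : ℝ → ℝ}
  {v : ℝ → EuclideanSpace ℝ (Fin N)}

-- Symmetry cancels the `A₀` terms when the eigenvector equations at `s` and `t` are each paired
-- with the other vector.
open Matrix in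
theorem IsAnalyticEigenpair.sub_mul_inner (h : IsAnalyticEigenpair A₀ A₁ lam v)
    (h₀ : A₀.IsHermitian) (h₁ : A₁.IsHermitian) {s t : ℝ} (hs : s ∈ Icc (0 : ℝ) 1)
    (ht : t ∈ Icc (0 : ℝ) 1) :
    (lam s - lam t) * ⟪v t, v s⟫ = (s - t) * ⟪toEuclideanLin A₁ (v t), v s⟫ := by
  have e₀ := isSymmetric_toEuclideanLin_iff.mpr h₀ (v t) (v s)
  have e₁ := isSymmetric_toEuclideanLin_iff.mpr h₁ (v t) (v s)
  have es := congrArg (fun x => ⟪v t, x⟫) (h.eigen s hs)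
  have et := congrArg (fun x => ⟪x, v s⟫) (h.eigen t ht)
  simp only [map_add, map_smul, LinearMap.add_apply, LinearMap.smul_apply, inner_add_left,
    inner_add_right, inner_smul_left, inner_smul_right, conj_trivial] at es et
  linear_combination et - es - e₀ - s * e₁

open Matrix in
/-- The Hellmann–Feynman formula. -/
theorem IsAnalyticEigenpair.deriv_mul_norm_sq (h : IsAnalyticEigenpair A₀ A₁ lam v)
    (h₀ : A₀.IsHermitian) (h₁ : A₁.IsHermitian) {t : ℝ} (ht : t ∈ Ioo (0 : ℝ) 1) :
    deriv lam t * ‖v t‖ ^ 2 = ⟪toEuclideanLin A₁ (v t), v t⟫ := by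
  have ht' := Ioo_subset_Icc_self ht
  have hl := (h.analytic_value t ht').differentiableAt.hasDerivAt
  have hv := (h.analytic_vector t ht').differentiableAt.hasDerivAt
  -- Both sides of `sub_mul_inner` are differentiated in `s` at `s = t`; the terms containing `v'`
  -- carry a factor that vanishes there.
  have hL := (hl.sub_const (lam t)).mul ((hasDerivAt_const t (v t)).inner ℝ hv)
  have hR := ((hasDerivAt_id t).sub_const t).mul
    ((hasDerivAt_const t (toEuclideanLin A₁ (v t))).inner ℝ hv)
  have key := hL.unique (hR.congr_of_eventuallyEq ?_)
  · simpa using key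
  · filter_upwards [Icc_mem_nhds ht.1 ht.2] with s hs
    exact h.sub_mul_inner h₀ h₁ hs ht'

theorem IsAnalyticEigenpair.abs_sub_le (h : IsAnalyticEigenpair A₀ A₁ lam v)
    (h₀ : A₀.IsHermitian) (h₁ : A₁.IsHermitian) {t : ℝ} (ht : t ∈ Icc (0 : ℝ) 1) :
    |lam t - lam 0| ≤ t * ‖A₁‖ := by
  rcases ht.1.eq_or_lt with rfl | h0t
  · simp
  have hsub : Icc 0 t ⊆ Icc (0 : ℝ) 1 := Icc_subset_Icc_right ht.2
  obtain ⟨c, hc, hd⟩ := exists_deriv_eq_slope lam h0t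
    (h.analytic_value.continuousOn.mono hsub)
    ((h.analytic_value.mono (Ioo_subset_Icc_self.trans hsub)).differentiableOn)
  have hc' : c ∈ Ioo (0 : ℝ) 1 := ⟨hc.1, hc.2.trans_le ht.2⟩
  have hv : 0 < ‖v c‖ ^ 2 := by
    have := norm_pos_iff.mpr (h.vector_ne_zero c (Ioo_subset_Icc_self hc'))
    positivity
  have hderiv : |deriv lam c| ≤ ‖A₁‖ := by
    refine le_of_mul_le_mul_right ?_ hv
    rw [← abs_of_pos hv, ← abs_mul, h.deriv_mul_norm_sq h₀ h₁ hc', abs_of_pos hv]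
    calc _ ≤ _ := abs_real_inner_le_norm _ _
      _ ≤ ‖A₁‖ * ‖v c‖ * ‖v c‖ := by
        gcongr
        exact A₁.norm_toEuclideanLin_le_frobenius _
      _ = _ := by ring
  have heq : lam t - lam 0 = t * deriv lam c := by
    rw [hd, sub_zero]
    field_simp
  rw [heq, abs_mul, abs_of_pos h0t]
  gcongr

/-- The component of an aligned eigenvector curve orthogonal to its initial vector is controlled
by the spectral gap. -/
theorem IsAnalyticEigenpair.gap_mul_norm_orthogonal_le (h : IsAnalyticEigenpair A₀ A₁ lam v)
    (h₀ : A₀.IsHermitian) (h₁ : A₁.IsHermitian) (hal : IsAligned A₀ (lam 0) v)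
    (hv₀ : ‖v 0‖ = 1) {g : ℝ} (hg : 0 < g) (hgap : ∀ x ∈ positiveSpectralDistances A₀, g ≤ x)
    {t : ℝ} (ht : t ∈ Icc (0 : ℝ) 1) :
    g * ‖v t - ⟪v 0, v t⟫ • v 0‖ ≤ 2 * ‖A₁‖ * ‖v t‖ := by
  set T₀ := Matrix.toEuclideanLin A₀
  have hT : T₀.IsSymmetric := Matrix.isSymmetric_toEuclideanLin_iff.mpr h₀
  have heig : T₀ (v 0) = lam 0 • v 0 := by simpa using h.eigen 0 (by simp)
  have hv₀' : ⟪v 0, v 0⟫ = 1 := by rw [real_inner_self_eq_norm_sq, hv₀, one_pow]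
  have hlam : lam 0 ∈ spectrum ℝ A₀ := by
    rw [← Matrix.spectrum_toLpLin 2]
    exact (Module.End.hasEigenvalue_of_hasEigenvector
      ⟨Module.End.mem_eigenspace_iff.mpr heig, h.vector_ne_zero 0 (by simp)⟩).mem_spectrum
  have hbelow := hT.gap_mul_norm_le (μ := lam 0) (w := v t - ⟪v 0, v t⟫ • v 0) hg.le
    (fun ν hν hne => by
      have hν' := hν.mem_spectrum
      rw [Matrix.spectrum_toLpLin] at hν'
      rcases hne.lt_or_gt with hlt | hlt
      · rw [abs_sub_comm, abs_of_pos (sub_pos.mpr hlt)]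
        exact hgap _ ⟨sub_pos.mpr hlt, _, hlam, _, hν', rfl⟩
      · rw [abs_of_pos (sub_pos.mpr hlt)]
        exact hgap _ ⟨sub_pos.mpr hlt, _, hν', _, hlam, rfl⟩)
    (fun u hu => by
      -- Alignment only concerns eigenvectors orthogonal to `v 0`, so the `v 0` component of `u` is
      -- removed first.
      have hz : ⟪u - ⟪v 0, u⟫ • v 0, v t⟫ = 0 := by
        refine hal _ ?_ ?_ t ht
        · change T₀ _ = _
          rw [map_sub, map_smul, heig, hu, smul_sub, smul_comm]
        · rw [inner_sub_left, inner_smul_left, hv₀', real_inner_comm]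
          simp
      rw [inner_sub_left, inner_smul_left, conj_trivial] at hz
      rw [inner_sub_right, inner_smul_right, real_inner_comm (v 0) u]
      linarith)
  have hres : T₀ (v t - ⟪v 0, v t⟫ • v 0) - lam 0 • (v t - ⟪v 0, v t⟫ • v 0) =
      (lam t - lam 0) • v t - t • Matrix.toEuclideanLin A₁ (v t) := by
    have et := h.eigen t ht
    simp only [map_add, map_smul, LinearMap.add_apply, LinearMap.smul_apply] at et
    rw [map_sub, map_smul, heig, sub_smul, ← et]
    module
  refine hbelow.trans ?_
  rw [hres]
  calc _ ≤ ‖(lam t - lam 0) • v t‖ + ‖t • Matrix.toEuclideanLin A₁ (v t)‖ := norm_sub_le _ _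
    _ ≤ ‖A₁‖ * ‖v t‖ + 1 * (‖A₁‖ * ‖v t‖) := by
      rw [norm_smul, norm_smul, Real.norm_eq_abs, Real.norm_eq_abs, abs_of_nonneg ht.1]
      gcongr
      · exact (h.abs_sub_le h₀ h₁ ht).trans (mul_le_of_le_one_left (norm_nonneg _) ht.2)
      · exact ht.2
      · exact A₁.norm_toEuclideanLin_le_frobenius _
    _ = _ := by ring

/-- A small orthogonal component leaves `v 1` near `v 0` or near `-v 0`. Continuity excludes the
latter: `⟪v 0, v t⟫` starts at `1` and never vanishes. -/
theorem IsAnalyticEigenpair.norm_sub_le_of_unitNormalized (h : IsAnalyticEigenpair A₀ A₁ lam v)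
    (h₀ : A₀.IsHermitian) (h₁ : A₁.IsHermitian) (hal : IsAligned A₀ (lam 0) v)
    (hu : IsUnitNormalized v) {g : ℝ} (hg : 0 < g)
    (hgap : ∀ x ∈ positiveSpectralDistances A₀, g ≤ x) (hA : ‖A₁‖ < g / 6) :
    ‖v 1 - v 0‖ ≤ 4 * ‖A₁‖ / g := by
  have hv₀ := hu 0 (by simp)
  have hw : ∀ t ∈ Icc (0 : ℝ) 1, ‖v t - ⟪v 0, v t⟫ • v 0‖ ≤ 2 * ‖A₁‖ / g := by
    intro t ht
    rw [le_div_iff₀' hg]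
    simpa [hu t ht] using h.gap_mul_norm_orthogonal_le h₀ h₁ hal hv₀ hg hgap ht
  have hsmall : 2 * ‖A₁‖ / g < 1 := by rw [div_lt_one hg]; linarith
  have hpyth : ∀ t ∈ Icc (0 : ℝ) 1, ‖v t - ⟪v 0, v t⟫ • v 0‖ ^ 2 = 1 - ⟪v 0, v t⟫ ^ 2 := by
    intro t ht
    rw [norm_sub_sq_real, norm_smul, inner_smul_right, hu t ht, hv₀, real_inner_comm,
      Real.norm_eq_abs, mul_one, sq_abs]
    ring
  have hcont : ContinuousOn (fun t => ⟪v 0, v t⟫) (Icc 0 1) :=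
    continuousOn_const.inner h.analytic_vector.continuousOn
  have hne : ∀ t ∈ Icc (0 : ℝ) 1, ⟪v 0, v t⟫ ≠ 0 := by
    intro t ht h0
    have hlt := pow_lt_one₀ (norm_nonneg _) ((hw t ht).trans_lt hsmall) two_ne_zero
    rw [hpyth t ht, h0] at hlt
    norm_num at hlt
  have hone : (1 : ℝ) ∈ Icc (0 : ℝ) 1 := by simp
  have hpos : 0 < ⟪v 0, v 1⟫ := by
    by_contra! hneg
    obtain ⟨t, ht, h0⟩ := intermediate_value_Icc' zero_le_one hcont
      (show (0 : ℝ) ∈ Icc _ _ from ⟨hneg, by simp⟩)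
    exact hne t ht h0
  have hle : ⟪v 0, v 1⟫ ≤ 1 := by
    have := real_inner_le_norm (v 0) (v 1)
    rwa [hv₀, hu 1 hone, one_mul] at this
  have hdist : ‖v 1 - v 0‖ ^ 2 = 2 - 2 * ⟪v 0, v 1⟫ := by
    rw [norm_sub_sq_real, hu 1 hone, hv₀, real_inner_comm]
    ring
  have hfin : ‖v 1 - v 0‖ ≤ 2 * ‖v 1 - ⟪v 0, v 1⟫ • v 0‖ := by
    refine le_of_sq_le_sq ?_ (by positivity)
    rw [hdist, mul_pow, hpyth 1 hone]
    -- With `c = ⟪v 0, v 1⟫ ∈ (0, 1]`, this is `2 (1 - c) ≤ 4 (1 - c) (1 + c)`.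
    nlinarith
  calc _ ≤ _ := hfin
    _ ≤ 2 * (2 * ‖A₁‖ / g) := by gcongr; exact hw 1 hone
    _ = _ := by ring

/-- Here `‖v 1‖` is not known in advance. For `x = ‖v 1 - v 0‖`, the bound `g x ≤ 2 ‖A₁‖ (x + 1)`
with `‖A₁‖ < g / 6` first gives `x ≤ 1 / 2`, which is then reinserted. -/
theorem IsAnalyticEigenpair.norm_sub_le_of_intermediateNormalized
    (h : IsAnalyticEigenpair A₀ A₁ lam v)
    (h₀ : A₀.IsHermitian) (h₁ : A₁.IsHermitian) (hal : IsAligned A₀ (lam 0) v)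
    (hi : IsIntermediateNormalized v) {g : ℝ} (hg : 0 < g)
    (hgap : ∀ x ∈ positiveSpectralDistances A₀, g ≤ x) (hA : ‖A₁‖ < g / 6) :
    ‖v 1 - v 0‖ ≤ 4 * ‖A₁‖ / g := by
  have hone : (1 : ℝ) ∈ Icc (0 : ℝ) 1 := by simp
  have hw := h.gap_mul_norm_orthogonal_le h₀ h₁ hal hi.1 hg hgap hone
  rw [hi.2 1 hone, one_smul] at hw
  have htri : ‖v 1‖ ≤ ‖v 1 - v 0‖ + 1 := by
    simpa [hi.1] using norm_add_le (v 1 - v 0) (v 0)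
  have hhalf : ‖v 1 - v 0‖ ≤ 1 / 2 := by
    refine le_of_mul_le_mul_left ?_ hg
    nlinarith [norm_nonneg (v 1)]
  rw [le_div_iff₀' hg]
  nlinarith [norm_nonneg A₁]

end Eigenpair

theorem le_two_mul_mul_inv_one_add {x y : ℝ} (hx : 0 ≤ x) (hy : 0 ≤ y) (hy' : y ≤ 1) :
    x ≤ 2 * x * (1 + y)⁻¹ := by
  rw [← div_eq_mul_inv, le_div_iff₀ (by linarith)]
  nlinarith

theorem mainTheorem1 :
    ∃ Cl : ℝ, 0 < Cl ∧ ∃ K : ℝ, 0 < K ∧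
      ∀ (N : ℕ) (A₀ : Matrix (Fin N) (Fin N) ℝ), A₀.IsSymm →
        -- `d` is the minimal positive spectral distance of `A₀`
        (∀ d : ℝ, IsLeast (positiveSpectralDistances A₀) d →
          ∀ A₁ : Matrix (Fin N) (Fin N) ℝ, A₁.PosSemidef → ‖A₁‖ < d / 6 →
            ∀ (lam : ℝ → ℝ) (v : ℝ → EuclideanSpace ℝ (Fin N)),
              IsAnalyticEigenpair A₀ A₁ lam v →
                |lam 1 - lam 0| ≤ Cl * ‖A₁‖ * (1 + ‖A₁‖ / (d / 6))⁻¹ ∧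
                (IsAligned A₀ (lam 0) v → (IsUnitNormalized v ∨ IsIntermediateNormalized v) →
                  ‖v 1 - v 0‖ ≤ (K / d) * ‖A₁‖ * (1 + ‖A₁‖ / (d / 6))⁻¹)) ∧
        -- `d` is the smallest positive entry of `A₀`
        (∃ Cv : ℝ, 0 < Cv ∧ ∀ d : ℝ, IsLeast (positiveEntries A₀) d →
          ∀ A₁ : Matrix (Fin N) (Fin N) ℝ, A₁.PosSemidef → ‖A₁‖ < d / 6 →
            ∀ (lam : ℝ → ℝ) (v : ℝ → EuclideanSpace ℝ (Fin N)),
              IsAnalyticEigenpair A₀ A₁ lam v →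
                |lam 1 - lam 0| ≤ Cl * ‖A₁‖ * (1 + ‖A₁‖ / (d / 6))⁻¹ ∧
                (IsAligned A₀ (lam 0) v → IsUnitNormalized v →
                  ‖v 1 - v 0‖ ≤ Cv * ‖A₁‖ * (1 + ‖A₁‖ / (d / 6))⁻¹)) := by
  refine ⟨2, two_pos, 8, by norm_num, fun N A₀ hA₀ => ?_⟩
  have h₀ : A₀.IsHermitian := by
    rw [Matrix.IsHermitian, Matrix.conjTranspose_eq_transpose_of_trivial]
    exact hA₀
  have hquot : ∀ {a d : ℝ}, 0 < d → 0 ≤ a → a < d / 6 → ∀ {x : ℝ}, 0 ≤ x →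
      x ≤ 2 * x * (1 + a / (d / 6))⁻¹ := fun hd ha had x hx =>
    le_two_mul_mul_inv_one_add hx (by positivity) ((div_lt_one (by positivity)).mpr had).le
  have hval : ∀ d : ℝ, 0 < d → ∀ A₁ : Matrix (Fin N) (Fin N) ℝ, A₁.PosSemidef → ‖A₁‖ < d / 6 →
      ∀ (lam : ℝ → ℝ) (v : ℝ → EuclideanSpace ℝ (Fin N)), IsAnalyticEigenpair A₀ A₁ lam v →
        |lam 1 - lam 0| ≤ 2 * ‖A₁‖ * (1 + ‖A₁‖ / (d / 6))⁻¹ := by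
    intro d hd A₁ hA₁ hlt lam v h
    have := h.abs_sub_le h₀ hA₁.isHermitian (t := 1) (by simp)
    rw [one_mul] at this
    exact this.trans (hquot hd (norm_nonneg _) hlt (norm_nonneg _))
  refine ⟨?_, ?_⟩
  · intro d hd A₁ hA₁ hlt lam v h
    have hd₀ : 0 < d := hd.1.1
    refine ⟨hval d hd₀ A₁ hA₁ hlt lam v h, fun hal hn => ?_⟩
    have hvec : ‖v 1 - v 0‖ ≤ 4 * ‖A₁‖ / d := by
      rcases hn with hn | hn
      · exact h.norm_sub_le_of_unitNormalized h₀ hA₁.isHermitian hal hn hd₀ (fun _ => (hd.2 ·)) hlt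
      · exact h.norm_sub_le_of_intermediateNormalized h₀ hA₁.isHermitian hal hn hd₀
          (fun _ => (hd.2 ·)) hlt
    calc _ ≤ _ := hvec
      _ ≤ 2 * (4 * ‖A₁‖ / d) * (1 + ‖A₁‖ / (d / 6))⁻¹ :=
        hquot hd₀ (norm_nonneg _) hlt (by positivity)
      _ = _ := by ring
  · obtain ⟨g, hg, hgap⟩ := exists_spectral_gap A₀
    refine ⟨24 / g, by positivity, fun d hd A₁ hA₁ hlt lam v h => ?_⟩
    have hd₀ : 0 < d := hd.1.1
    refine ⟨hval d hd₀ A₁ hA₁ hlt lam v h, fun hal hn => ?_⟩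
    have hvec : ‖v 1 - v 0‖ ≤ 12 * ‖A₁‖ / g := by
      rcases lt_or_ge ‖A₁‖ (g / 6) with hA | hA
      · refine (h.norm_sub_le_of_unitNormalized h₀ hA₁.isHermitian hal hn hg hgap hA).trans ?_
        gcongr
        norm_num
      -- For large `A₁` the trivial bound `2` for unit vectors is enough, as `2 ≤ 12 ‖A₁‖ / g`; this
      -- fixes the constant `12`.
      · have htri := norm_sub_le (v 1) (v 0)
        rw [hn 1 (by simp), hn 0 (by simp)] at htri
        rw [le_div_iff₀ hg]
        nlinarith
    calc _ ≤ _ := hvec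
      _ ≤ 2 * (12 * ‖A₁‖ / g) * (1 + ‖A₁‖ / (d / 6))⁻¹ :=
        hquot hd₀ (norm_nonneg _) hlt (by positivity)
      _ = _ := by ring
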